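/- Let $G$ be a totally disconnected, locally compact group and let $\alpha\colon G\to G$ be an endomorphism, that is, a continuous homomorphism. Call a subset of $G$ bounded if its closure in $G$ is compact. For $x\in G$, an $\alpha$-regressive sequence for $x$ is a sequence $(x_n)_{n\ge 0}$ in $G$ with $x_0=x$ and $\alpha(x_{n+1})=x_n$ for all $n\ge 0$. Define \[ P_\alpha=\{x\in G : \{\alpha^n(x) : n\ge 0\}\text{ is bounded}\}, \] \[ P_\alpha^{-}=\{x\in G : \text{there is an }\alpha\text{-regressive sequence }(x_n)_{n\ge 0}\text{ for }x\text{ such that }\{x_n : n\ge 0\}\text{ is bounded}\}, \] \[ M_\alpha=P_\alpha\cap P_\alpha^{-} \] (the parabolic, anti-parabolic and Levi subgroups of $\alpha$). Then each of $P_\alpha$, $P_\alpha^{-}$ and $M_\alpha$ is a closed subgroup of $G$ and is $\alpha$-invariant, that is, $\alpha(H)\subseteq H$ for $H\in\{P_\alpha,P_\alpha^{-},M_\alpha\}$. -/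

import Mathlib

/-- A subset of a topological space is bounded when it has compact closure. -/
def HasCompactClosure {G : Type*} [TopologicalSpace G] (S : Set G) : Prop :=
  IsCompact (closure S)

/-- `u` is an `α`-regressive sequence for `x`: `u 0 = x` and `α (u (n + 1)) = u n` for all `n`. -/
def IsRegressiveSeq {G : Type*} (α : G → G) (x : G) (u : ℕ → G) : Prop :=
  u 0 = x ∧ ∀ n : ℕ, α (u (n + 1)) = u n

/-- The parabolic subset of `α`: the points with bounded forward orbit. -/
def parabolic {G : Type*} [TopologicalSpace G] (α : G → G) : Set G :=
  {x | HasCompactClosure (Set.range fun n : ℕ => α^[n] x)}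

/-- The anti-parabolic subset of `α`: the points with a bounded `α`-regressive sequence. -/
def antiParabolic {G : Type*} [TopologicalSpace G] (α : G → G) : Set G :=
  {x | ∃ u : ℕ → G, IsRegressiveSeq α x u ∧ HasCompactClosure (Set.range u)}

/-- The Levi subset of `α`: the intersection of the parabolic and anti-parabolic subsets. -/
def levi {G : Type*} [TopologicalSpace G] (α : G → G) : Set G :=
  parabolic α ∩ antiParabolic α

/-- The set `S` is (the underlying set of) a closed subgroup `H` of `G` with `α(H) ⊆ H`. -/
def IsClosedInvariantSubgroup {G : Type*} [Group G] [TopologicalSpace G] (α : G → G)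
    (S : Set G) : Prop :=
  ∃ H : Subgroup G, (H : Set G) = S ∧ IsClosed (H : Set G) ∧ ∀ x ∈ H, α x ∈ H

/-!
Let `U` be a compact open subgroup of `G`, which exists by van Dantzig's theorem. By compactness,
every `x` in a smaller open subgroup `V` can be corrected by a bi-infinite orbit with past in `U`
so that the rest of its forward orbit lies in `U`. In particular a bi-infinite orbit starting in
`V` is the product of one with past in `U` and one with future in `U`. The orbits which lie in `U`
at all but finitely many times take values in a compact set `L`, independent of the orbit.

A bounded forward orbit meets some coset of `V` at two times as far apart as desired. Factoring
the quotient of the orbit's two translates to these times expresses its values through those of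
an orbit in `L`. So every bounded forward orbit starting in `V` lies in the fixed compact set
`U * L * U`, and time reversal gives the same for bounded regressive sequences. Hence the
parabolic and anti-parabolic subgroups intersect `V` in closed sets, and a subgroup whose
intersection with a neighbourhood of the identity is closed is itself closed.
-/

open Filter
open scoped Pointwise

section TopologicalGroup

variable {G : Type*} [Group G] [TopologicalSpace G] [IsTopologicalGroup G]

theorem isOpen_stabilizer_of_isCompact_of_isOpen {W : Set G} (hWc : IsCompact W)
    (hWo : IsOpen W) : IsOpen (MulAction.stabilizer G W : Set G) := by
  obtain ⟨T, hT, hTW⟩ := compact_open_separated_mul_left hWc hWo subset_rfl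
  refine (MulAction.stabilizer G W).isOpen_of_mem_nhds (g := 1) ?_
  filter_upwards [hT, inv_mem_nhds_one G hT] with g hg hg_inv
  refine MulAction.mem_stabilizer_set.2 fun w => ⟨fun hw => ?_, fun hw => ?_⟩
  · simpa using hTW (Set.mul_mem_mul hg_inv hw)
  · exact hTW (Set.mul_mem_mul hg hw)

/-- **Van Dantzig's theorem**. -/
theorem exists_subgroup_isOpen_isCompact [LocallyCompactSpace G] [TotallyDisconnectedSpace G] :
    ∃ U : Subgroup G, IsOpen (U : Set G) ∧ IsCompact (U : Set G) := by
  obtain ⟨K, hK, hK_nhds⟩ := exists_compact_mem_nhds (1 : G)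
  obtain ⟨W, hW, h1W, hWK⟩ := loc_compact_Haus_tot_disc_of_zero_dim.mem_nhds_iff.1 hK_nhds
  have hWc : IsCompact W := hK.of_isClosed_subset hW.isClosed hWK
  have h_open := isOpen_stabilizer_of_isCompact_of_isOpen hWc hW.isOpen
  refine ⟨MulAction.stabilizer G W, h_open,
    hWc.of_isClosed_subset (Subgroup.isClosed_of_isOpen _ h_open) fun g hg => ?_⟩
  simpa using (MulAction.mem_stabilizer_set.1 hg 1).2 h1W

theorem isClosed_subgroup_of_isClosed_inter {H : Subgroup G} {V : Set G} (hV : IsOpen V)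
    (h1 : 1 ∈ V) (hHV : IsClosed ((H : Set G) ∩ V)) : IsClosed (H : Set G) := by
  refine isClosed_of_closure_subset fun x hx => ?_
  have hxV : IsOpen {g : G | g⁻¹ * x ∈ V} :=
    hV.preimage (continuous_inv.mul continuous_const)
  obtain ⟨g, hgV, hgH⟩ := mem_closure_iff.1 hx _ hxV (by simpa using h1)
  have h_closure : g⁻¹ * x ∈ closure (H : Set G) :=
    H.topologicalClosure.mul_mem (subset_closure (H.inv_mem hgH)) hx
  have h_inter : g⁻¹ * x ∈ (H : Set G) ∩ V := by
    rw [← hHV.closure_eq, Set.inter_comm]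
    exact hV.inter_closure ⟨hgV, h_closure⟩
  simpa using H.mul_mem hgH h_inter.1

theorem exists_finite_subset_inv_mul_mem {ι : Type*} {U : Subgroup G} (hU : IsOpen (U : Set G))
    {K : Set G} (hK : IsCompact K) {s : Set ι} {g : ι → G} (hg : Set.MapsTo g s K) :
    ∃ r ⊆ s, r.Finite ∧ ∀ i ∈ s, ∃ j ∈ r, (g j)⁻¹ * g i ∈ U := by
  have : DiscreteTopology (G ⧸ U) := QuotientGroup.discreteTopology hU
  have hK_fin : ((QuotientGroup.mk : G → G ⧸ U) '' K).Finite :=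
    (hK.image QuotientGroup.continuous_mk).finite_of_discrete
  obtain ⟨r, hrs, hr⟩ := s.exists_subset_bijOn fun i => (g i : G ⧸ U)
  refine ⟨r, hrs, hr.finite_iff_finite.2 (hK_fin.subset ?_), fun i hi => ?_⟩
  · rintro _ ⟨i, hi, rfl⟩
    exact ⟨g i, hg hi, rfl⟩
  · obtain ⟨j, hj, hji⟩ := hr.surjOn ⟨i, hi, rfl⟩
    exact ⟨j, hj, QuotientGroup.eq.1 hji⟩

theorem exists_add_le_inv_mul_mem {U : Subgroup G} (hU : IsOpen (U : Set G)) {K : Set G}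
    (hK : IsCompact K) {s : ℕ → G} (hs : ∀ n, s n ∈ K) (m : ℕ) :
    ∃ p q, p + m ≤ q ∧ (s p)⁻¹ * s q ∈ U := by
  obtain ⟨r, -, hr, hsr⟩ :=
    exists_finite_subset_inv_mul_mem hU hK fun n (_ : n ∈ Set.univ) => hs n
  obtain ⟨B, hB⟩ := hr.bddAbove
  obtain ⟨p, hp, hpB⟩ := hsr (B + m) (Set.mem_univ _)
  exact ⟨p, B + m, Nat.add_le_add_right (hB hp) m, hpB⟩

theorem exists_isCompact_forall_subset_of_subset_mul {U : Subgroup G}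
    (hU : IsCompact (U : Set G)) {T D : ℕ → Set G} (hT : ∀ k, IsCompact (T k))
    (hTU : ∀ᶠ k in atTop, T k ⊆ U) {K : Set G} (hK : IsCompact K) (hD0 : D 0 ⊆ K)
    (hD : ∀ k, D (k + 1) ⊆ T k * D k) : ∃ C, IsCompact C ∧ ∀ k, D k ⊆ C := by
  have hD_bdd : ∀ k, ∃ L, IsCompact L ∧ D k ⊆ L := fun k => by
    induction k with
    | zero => exact ⟨K, hK, hD0⟩
    | succ k ih =>
      obtain ⟨L, hL, hDL⟩ := ih
      exact ⟨T k * L, (hT k).mul hL, (hD k).trans (Set.mul_subset_mul_left hDL)⟩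
  choose L hL hDL using hD_bdd
  obtain ⟨N, hN⟩ := eventually_atTop.1 hTU
  have h_small : ∀ k, D k ⊆ U * L k := fun k =>
    (hDL k).trans (Set.subset_mul_right _ U.one_mem)
  have h_large : ∀ k ≥ N, D k ⊆ U * L N := fun k hk => by
    induction k, hk using Nat.le_induction with
    | base => exact h_small N
    | succ k hk ih =>
      calc D (k + 1) ⊆ T k * D k := hD k
        _ ⊆ U * (U * L N) := Set.mul_subset_mul (hN k hk) ih
        _ = U * L N := by rw [← mul_assoc, coe_mul_coe]
  refine ⟨⋃ k ∈ Set.Iic N, U * L k, (Set.finite_Iic N).isCompact_biUnion fun k _ =>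
    hU.mul (hL k), fun k => ?_⟩
  rcases le_total k N with hk | hk
  · exact (h_small k).trans (Set.subset_biUnion_of_mem (u := fun k => (U : Set G) * L k) hk)
  · exact (h_large k hk).trans
      (Set.subset_biUnion_of_mem (u := fun k => (U : Set G) * L k) Set.self_mem_Iic)

end TopologicalGroup

section BiinfiniteSequences

variable {G : Type*} [Group G]

/-- Invariance of a group of bi-infinite sequences under all translations of time. -/
def IsShiftInvariant (O : Subgroup (ℤ → G)) : Prop :=
  ∀ f ∈ O, ∀ k : ℤ, (fun n => f (n + k)) ∈ O

/-- The group of time reversals of the sequences in `O`. It turns statements about the future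
of a sequence into statements about its past. -/
def timeReversal (O : Subgroup (ℤ → G)) : Subgroup (ℤ → G) where
  carrier := {f | (fun n => f (-n)) ∈ O}
  mul_mem' := O.mul_mem
  one_mem' := O.one_mem
  inv_mem' := O.inv_mem

/-- The sequences in `O` homoclinic to `U`: those which lie in `U` both in the distant past and
in the distant future, that is, at all but finitely many times. -/
def homoclinic (O : Subgroup (ℤ → G)) (U : Subgroup G) : Subgroup (ℤ → G) where
  carrier := {f | f ∈ O ∧ ∀ᶠ n in cofinite, f n ∈ U}
  mul_mem' hf hg := ⟨O.mul_mem hf.1 hg.1, (hf.2.and hg.2).mono fun _ h => U.mul_mem h.1 h.2⟩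
  one_mem' := ⟨O.one_mem, Eventually.of_forall fun _ => U.one_mem⟩
  inv_mem' hf := ⟨O.inv_mem hf.1, hf.2.mono fun _ h => U.inv_mem h⟩

theorem eventually_cofinite_int {p : ℤ → Prop} {a b : ℤ} (ha : ∀ n ≤ a, p n)
    (hb : ∀ n ≥ b, p n) : ∀ᶠ n in cofinite, p n := by
  rw [Int.cofinite_eq, eventually_sup]
  exact ⟨eventually_atBot.2 ⟨a, ha⟩, eventually_atTop.2 ⟨b, hb⟩⟩

variable {O : Subgroup (ℤ → G)} {U V : Subgroup G} {L : Set G}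

theorem mem_timeReversal {f : ℤ → G} : f ∈ timeReversal O ↔ (fun n => f (-n)) ∈ O :=
  Iff.rfl

theorem IsShiftInvariant.timeReversal (hO : IsShiftInvariant O) :
    IsShiftInvariant (timeReversal O) := fun f hf k => by
  simpa only [mem_timeReversal, neg_add, neg_neg] using hO _ (mem_timeReversal.1 hf) (-k)

theorem IsShiftInvariant.homoclinic (hO : IsShiftInvariant O) :
    IsShiftInvariant (homoclinic O U) := fun f hf k =>
  ⟨hO f hf.1 k, (add_left_injective k).tendsto_cofinite.eventually hf.2⟩

/-- The past and the future of the sequences in `O` can be prescribed independently near the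
identity: a sequence starting in `V` is the product of one with past in `U` and one with
future in `U`. Two such factorizations differ by a homoclinic sequence, and these take
values in `L`. -/
structure LocalProductStructure (O : Subgroup (ℤ → G)) (U V : Subgroup G) (L : Set G) :
    Prop where
  isShiftInvariant : IsShiftInvariant O
  exists_mul_eq : ∀ f ∈ O, f 0 ∈ V → ∃ a ∈ O, ∃ b ∈ O,
    (∀ n ≤ 0, a n ∈ U) ∧ (∀ n ≥ 0, b n ∈ U) ∧ a * b = f
  mem_of_homoclinic : ∀ f ∈ homoclinic O U, ∀ n, f n ∈ L

namespace LocalProductStructure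

theorem timeReversal (h : LocalProductStructure O U V L) :
    LocalProductStructure (timeReversal O) U V L where
  isShiftInvariant := h.isShiftInvariant.timeReversal
  exists_mul_eq f hf hf0 := by
    obtain ⟨a, ha, b, hb, haU, hbU, hab⟩ :=
      h.exists_mul_eq _ (O.inv_mem hf) (V.inv_mem (by simpa using hf0))
    refine ⟨fun n => (b (-n))⁻¹, ?_, fun n => (a (-n))⁻¹, ?_, fun n hn => ?_, fun n hn => ?_, ?_⟩
    · simp only [mem_timeReversal, neg_neg]
      exact O.inv_mem hb
    · simp only [mem_timeReversal, neg_neg]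
      exact O.inv_mem ha
    · exact U.inv_mem (hbU _ (by omega))
    · exact U.inv_mem (haU _ (by omega))
    · funext n
      simpa using congrArg (·⁻¹) (congrFun hab (-n))
  mem_of_homoclinic f hf n := by
    simpa using h.mem_of_homoclinic (fun n => f (-n))
      ⟨hf.1, neg_injective.tendsto_cofinite.eventually hf.2⟩ (-n)

variable [TopologicalSpace G] [IsTopologicalGroup G] {K : Set G} {f : ℤ → G}

/- The recurrence `f q ∈ f p * V` makes `g n = (f (n + p))⁻¹ * f (n + q)` start in `V`. The
second factor of `g = a * b` is homoclinic, and
`f m = (f (p + m - q) * a (m - q)) * b (m - q)`, where the first product is in `U`. -/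
theorem mem_mul_of_past_mem (h : LocalProductStructure O U V L) (hV : IsOpen (V : Set G))
    (hK : IsCompact K) (hf : f ∈ O) (hf_past : ∀ n ≤ 0, f n ∈ U) (hfK : ∀ n ≥ 0, f n ∈ K) :
    ∀ m ≥ 0, f m ∈ (U : Set G) * L := by
  intro m hm
  lift m to ℕ using hm
  obtain ⟨p, q, hpq, hfV⟩ :=
    exists_add_le_inv_mul_mem hV hK (fun n : ℕ => hfK n n.cast_nonneg) m
  obtain ⟨a, -, b, hb, haU, hbU, hab⟩ := h.exists_mul_eq
    ((fun n => f (n + p))⁻¹ * fun n => f (n + q))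
    (O.mul_mem (O.inv_mem (h.isShiftInvariant f hf p)) (h.isShiftInvariant f hf q))
    (by simpa using hfV)
  have hab_apply : ∀ n, a n * b n = (f (n + p))⁻¹ * f (n + q) := congrFun hab
  have hb_past : ∀ n ≤ -(q : ℤ), b n ∈ U := fun n hn => by
    rw [← inv_mul_cancel_left (a n) (b n), hab_apply]
    exact U.mul_mem (U.inv_mem (haU n (by omega)))
      (U.mul_mem (U.inv_mem (hf_past _ (by omega))) (hf_past _ (by omega)))
  have hbL := h.mem_of_homoclinic b ⟨hb, eventually_cofinite_int hb_past hbU⟩ (m - q)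
  refine ⟨f (m - q + p) * a (m - q), U.mul_mem (hf_past _ (by omega)) (haU _ (by omega)),
    b (m - q), hbL, ?_⟩
  simp [mul_assoc, hab_apply]

theorem mem_mul_mul_of_bounded (h : LocalProductStructure O U V L) (hV : IsOpen (V : Set G))
    (hU : IsCompact (U : Set G)) (hK : IsCompact K) (hf : f ∈ O) (hf0 : f 0 ∈ V)
    (hfK : ∀ n ≥ 0, f n ∈ K) : ∀ n ≥ 0, f n ∈ (U : Set G) * L * U := by
  obtain ⟨a, ha, b, -, haU, hbU, rfl⟩ := h.exists_mul_eq f hf hf0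
  have haK : ∀ n ≥ 0, a n ∈ K * U := fun n hn =>
    ⟨_, hfK n hn, _, U.inv_mem (hbU n hn), by simp⟩
  exact fun n hn => Set.mul_mem_mul
    (h.mem_mul_of_past_mem hV (hK.mul hU) ha haU haK n hn) (hbU n hn)

end LocalProductStructure

theorem exists_mul_of_homoclinic_of_past_mem (hO : IsShiftInvariant O) {R : Set (ℤ → G)}
    (hR : R ⊆ {f ∈ homoclinic O U | ∀ n < 0, f n ∈ U})
    (hR_cover : ∀ f ∈ {f ∈ homoclinic O U | ∀ n < 0, f n ∈ U}, ∃ r ∈ R, (r 0)⁻¹ * f 0 ∈ U)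
    {f : ℤ → G} (hf : f ∈ homoclinic O U) {k : ℤ} (hf_past : ∀ n < -k, f n ∈ U) :
    ∃ r ∈ R, ∃ g ∈ homoclinic O U, (∀ n ≤ -k, g n ∈ U) ∧ r k * g 0 = f 0 := by
  obtain ⟨r, hrR, hr⟩ := hR_cover (fun n => f (n + -k))
    ⟨hO.homoclinic f hf (-k), fun n hn => hf_past _ (by omega)⟩
  obtain ⟨hr_hom, hr_past⟩ := hR hrR
  refine ⟨r, hrR, (fun n => r (n + k))⁻¹ * f,
    mul_mem (inv_mem (hO.homoclinic r hr_hom k)) hf, fun n hn => ?_, by simp⟩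
  rcases hn.eq_or_lt with rfl | hn
  · simpa using hr
  · exact U.mul_mem (U.inv_mem (hr_past _ (by omega))) (hf_past n hn)

/- Let `D k` be the set of values at time `0` of the homoclinic sequences lying in `U` up to
time `-k`. Dividing by one of finitely many sequences `r` gives `D (k + 1) ⊆ {r k} * D k`,
where `r k ∈ U` for large `k`. -/
theorem exists_isCompact_of_homoclinic [TopologicalSpace G] [IsTopologicalGroup G]
    (hO : IsShiftInvariant O) (hUo : IsOpen (U : Set G)) (hUc : IsCompact (U : Set G))
    {K : Set G} (hK : IsCompact K) (hOK : ∀ f ∈ O, (∀ n < 0, f n ∈ U) → f 0 ∈ K) :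
    ∃ L, IsCompact L ∧ ∀ f ∈ homoclinic O U, ∀ n, f n ∈ L := by
  obtain ⟨R, hR, hR_fin, hR_cover⟩ := exists_finite_subset_inv_mul_mem hUo hK
    (s := {f ∈ homoclinic O U | ∀ n < 0, f n ∈ U}) (g := fun f => f 0)
    fun f hf => hOK f hf.1.1 hf.2
  let D : ℕ → Set G := fun k => (fun f => f 0) '' {f ∈ homoclinic O U | ∀ n ≤ -(k : ℤ), f n ∈ U}
  have hD0 : D 0 ⊆ U := by
    rintro _ ⟨f, hf, rfl⟩
    exact hf.2 0 (by simp)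
  have hD_succ : ∀ k : ℕ, D (k + 1) ⊆ (fun r => r k) '' R * D k := by
    rintro k _ ⟨f, ⟨hf, hf_past⟩, rfl⟩
    obtain ⟨r, hr, g, hg, hg_past, h_mul⟩ := exists_mul_of_homoclinic_of_past_mem hO hR hR_cover
      hf (k := k) fun n hn => hf_past n (by push_cast; omega)
    exact ⟨_, ⟨r, hr, rfl⟩, _, ⟨g, ⟨hg, hg_past⟩, rfl⟩, h_mul⟩
  have hRU : ∀ᶠ k : ℕ in atTop, (fun r => r k) '' R ⊆ U := by
    simp only [Set.image_subset_iff]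
    refine (eventually_all_finite hR_fin).2 fun r hr => ?_
    rw [← Nat.cofinite_eq_atTop]
    exact Nat.cast_injective.tendsto_cofinite.eventually (hR hr).1.2
  obtain ⟨L, hL, hDL⟩ := exists_isCompact_forall_subset_of_subset_mul hUc
    (fun k => (hR_fin.image _).isCompact) hRU hUc hD0 hD_succ
  refine ⟨L, hL, fun f hf n => ?_⟩
  have h_shift := hO.homoclinic f hf n
  have h_past := h_shift.2
  rw [Int.cofinite_eq, eventually_sup, eventually_atBot] at h_past
  obtain ⟨M, hM⟩ := h_past.1
  exact hDL (-M).toNat ⟨_, ⟨h_shift, fun i hi => hM i (by omega)⟩, by simp⟩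

end BiinfiniteSequences

section Orbits

variable {G : Type*} [Group G]

/-- The group of bi-infinite orbits of `α`, which for a non-injective `α` also record a choice of
regressive sequence. -/
def biinfiniteOrbits (α : G →* G) : Subgroup (ℤ → G) where
  carrier := {f | ∀ n, α (f n) = f (n + 1)}
  mul_mem' hf hg n := by simp [hf n, hg n]
  one_mem' _ := map_one α
  inv_mem' hf n := by simp [hf n]

variable {α : G →* G} {f : ℤ → G}

theorem isShiftInvariant_biinfiniteOrbits : IsShiftInvariant (biinfiniteOrbits α) :=
  fun f hf k n => by rw [hf, add_right_comm]

theorem iterate_apply_zero (hf : ∀ n ≥ 0, α (f n) = f (n + 1)) (n : ℕ) :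
    α^[n] (f 0) = f n := by
  induction n with
  | zero => rfl
  | succ n ih => rw [Function.iterate_succ_apply', ih, hf n n.cast_nonneg, Nat.cast_succ]

theorem iterate_inv_mul (hf : f ∈ biinfiniteOrbits α) (x : G) (n : ℕ) :
    α^[n] ((f 0)⁻¹ * x) = (f n)⁻¹ * α^[n] x := by
  rw [iterate_map_mul, iterate_map_inv, iterate_apply_zero fun n _ => hf n]

theorem IsRegressiveSeq.exists_biinfiniteOrbits {x : G} {u : ℕ → G}
    (hu : IsRegressiveSeq α x u) : ∃ f ∈ biinfiniteOrbits α, ∀ n : ℕ, f (-n) = u n := by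
  refine ⟨fun n => α^[n.toNat] (u (-n).toNat), fun n => ?_, fun n => by simp⟩
  rcases lt_or_ge n 0 with hn | hn
  · have h_neg : (-n).toNat = (-(n + 1)).toNat + 1 := by omega
    simp [h_neg, Int.toNat_of_nonpos hn.le, Int.toNat_of_nonpos (Int.add_one_le_of_lt hn), hu.2]
  · have h_succ : (n + 1).toNat = n.toNat + 1 := by omega
    have h_neg : (-(n + 1)).toNat = (-n).toNat := by omega
    simp only [h_succ, h_neg, Function.iterate_succ_apply']

/-- The sequences with past in `C` which satisfy the orbit relation at the times in `S`:
bi-infinite orbits for `S = Set.univ`, orbits starting at time `-k` for `S = Set.Ici (-k)`. -/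
def orbitsWithPastIn (α : G →* G) (S : Set ℤ) (C : Set G) : Set (ℤ → G) :=
  {f | (∀ n ∈ S, α (f n) = f (n + 1)) ∧ ∀ n ≤ 0, f n ∈ C}

theorem mem_orbitsWithPastIn_univ {C : Set G} :
    f ∈ orbitsWithPastIn α Set.univ C ↔ f ∈ biinfiniteOrbits α ∧ ∀ n ≤ 0, f n ∈ C :=
  and_congr_left' ⟨fun h n => h n trivial, fun h n _ => h n⟩

theorem iInter_orbitsWithPastIn_Ici {C : Set G} :
    ⋂ k : ℕ, orbitsWithPastIn α (Set.Ici (-(k : ℤ))) C = orbitsWithPastIn α Set.univ C := by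
  ext f
  simp only [Set.mem_iInter]
  refine ⟨fun h => ⟨fun n _ => (h n.natAbs).1 n ?_, (h 0).2⟩,
    fun h k => ⟨fun n _ => h.1 n trivial, h.2⟩⟩
  simp only [Set.mem_Ici]
  omega

variable [TopologicalSpace G] [T2Space G]

/- The coordinates at positive times `n` need not lie in `C`, but they lie in `α^[n] '' C`. -/
theorem isCompact_orbitsWithPastIn (hα : Continuous α) {S : Set ℤ} (hS : Set.Ici 0 ⊆ S)
    {C : Set G} (hC : IsCompact C) : IsCompact (orbitsWithPastIn α S C) := by
  have h_closed : IsClosed {f : ℤ → G | ∀ n ∈ S, α (f n) = f (n + 1)} := by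
    simp only [Set.ofPred_forall]
    exact isClosed_biInter fun n _ =>
      isClosed_eq (hα.comp (continuous_apply n)) (continuous_apply (n + 1))
  have h_box : IsCompact (Set.univ.pi fun n : ℤ => α^[n.toNat] '' C) :=
    isCompact_univ_pi fun n => hC.image (hα.iterate _)
  convert h_box.inter_right h_closed using 1
  ext f
  refine ⟨fun hf => ⟨fun n _ => ?_, hf.1⟩, fun hf => ⟨hf.2, fun n hn => ?_⟩⟩
  · rcases le_total n 0 with hn | hn
    · exact ⟨f n, hf.2 n hn, by simp [Int.toNat_of_nonpos hn]⟩
    · lift n to ℕ using hn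
      exact ⟨f 0, hf.2 0 le_rfl, iterate_apply_zero (fun m hm => hf.1 m (hS hm)) n⟩
  · simpa [Int.toNat_of_nonpos hn] using hf.1 n trivial

end Orbits

section Factorization

variable {G : Type*} [Group G] {α : G →* G} {U : Subgroup G}

/-- The elements of `U` whose first `N` iterates under `α` remain in `U`. For large `N` these are
the elements which a bi-infinite orbit with past in `U` can correct. -/
def iteratesMemSubgroup (α : G →* G) (U : Subgroup G) (N : ℕ) : Subgroup G where
  carrier := {x | ∀ i ≤ N, α^[i] x ∈ U}
  mul_mem' hx hy i hi := by rw [iterate_map_mul]; exact U.mul_mem (hx i hi) (hy i hi)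
  one_mem' i _ := by rw [iterate_map_one]; exact U.one_mem
  inv_mem' hx i hi := by rw [iterate_map_inv]; exact U.inv_mem (hx i hi)

theorem exists_past_forall_le_inv_mul_iterate_mem {N : ℕ}
    (hN : ∀ x ∈ iteratesMemSubgroup α U N,
      ∃ f ∈ orbitsWithPastIn α Set.univ U, (f 1)⁻¹ * α^[N + 1] x ∈ U)
    {x : G} (hx : x ∈ iteratesMemSubgroup α U N) (M : ℕ) :
    ∃ f ∈ orbitsWithPastIn α Set.univ U, ∀ i ≤ N + M, (f i)⁻¹ * α^[i] x ∈ U := by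
  induction M with
  | zero =>
    exact ⟨1, mem_orbitsWithPastIn_univ.2 ⟨one_mem _, fun _ _ => U.one_mem⟩,
      fun i hi => by simpa using hx i hi⟩
  | succ M ih =>
    obtain ⟨f, hf, hfx⟩ := ih
    obtain ⟨hf_orbit, hf_past⟩ := mem_orbitsWithPastIn_univ.1 hf
    have h_iterate : ∀ i, α^[i] (α^[M] ((f 0)⁻¹ * x)) = (f ↑(i + M))⁻¹ * α^[i + M] x :=
      fun i => by rw [← Function.iterate_add_apply, iterate_inv_mul hf_orbit]
    obtain ⟨g, hg, hgx⟩ := hN (α^[M] ((f 0)⁻¹ * x)) fun i hi => by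
      rw [h_iterate]
      exact hfx _ (by omega)
    obtain ⟨hg_orbit, hg_past⟩ := mem_orbitsWithPastIn_univ.1 hg
    refine ⟨f * fun n => g (n + -(N + M : ℕ)), mem_orbitsWithPastIn_univ.2
      ⟨mul_mem hf_orbit (isShiftInvariant_biinfiniteOrbits g hg_orbit _), fun n hn =>
        U.mul_mem (hf_past n hn) (hg_past _ (by omega))⟩, fun i hi => ?_⟩
    rw [Pi.mul_apply, mul_inv_rev, mul_assoc]
    rcases hi.lt_or_eq with hi | rfl
    · exact U.mul_mem (U.inv_mem (hg_past _ (by omega))) (hfx i (by omega))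
    · have h_time : ((N + (M + 1) : ℕ) : ℤ) + -(N + M : ℕ) = 1 := by push_cast; ring
      rw [h_time, show N + (M + 1) = N + 1 + M by omega, ← h_iterate]
      exact hgx

variable [TopologicalSpace G]

theorem isOpen_iteratesMemSubgroup (hα : Continuous α) (hU : IsOpen (U : Set G)) (N : ℕ) :
    IsOpen (iteratesMemSubgroup α U N : Set G) := by
  change IsOpen {x | ∀ i ∈ Set.Iic N, α^[i] x ∈ U}
  simp only [Set.ofPred_forall]
  exact (Set.finite_Iic N).isOpen_biInter fun i _ => hU.preimage (hα.iterate i)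

variable [IsTopologicalGroup G] [T2Space G]

/- The orbits with past in `U` are the intersection of the decreasing compact sets of orbits in
`U` starting at time `-k`, so one of these sets lies in any neighbourhood of them. -/
theorem exists_forall_iterate_mem_past (hα : Continuous α)
    (hUo : IsOpen (U : Set G)) (hUc : IsCompact (U : Set G)) :
    ∃ N, ∀ x ∈ iteratesMemSubgroup α U N,
      ∃ f ∈ orbitsWithPastIn α Set.univ U, (f 1)⁻¹ * α^[N + 1] x ∈ U := by
  let W : Set (ℤ → G) := {g | ∃ f ∈ orbitsWithPastIn α Set.univ U, (f 1)⁻¹ * g 1 ∈ U}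
  have hW : IsOpen W := by
    have : W = ⋃ f ∈ orbitsWithPastIn α Set.univ (U : Set G), {g | (f 1)⁻¹ * g 1 ∈ U} := by
      ext g
      simp [W]
    rw [this]
    exact isOpen_biUnion fun f _ =>
      hUo.preimage (continuous_const.mul (continuous_apply (1 : ℤ)))
  have h_anti : Antitone fun k : ℕ => orbitsWithPastIn α (Set.Ici (-(k : ℤ))) (U : Set G) :=
    fun j k hjk f hf => ⟨fun n hn => hf.1 n (by simp only [Set.mem_Ici] at hn ⊢; omega), hf.2⟩
  obtain ⟨N, hN⟩ := exists_subset_nhds_of_isCompact h_anti.directed_ge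
    (fun k => isCompact_orbitsWithPastIn hα (Set.Ici_subset_Ici.2 (by simp)) hUc)
    (U := W) fun f hf => hW.mem_nhds
      ⟨f, iInter_orbitsWithPastIn_Ici.subset hf, by simp⟩
  refine ⟨N, fun x hx => ?_⟩
  have h_segment : (fun n : ℤ => α^[(N + n).toNat] x) ∈
      orbitsWithPastIn α (Set.Ici (-(N : ℤ))) (U : Set G) := by
    refine ⟨fun n hn => ?_, fun n hn => hx _ (by omega)⟩
    have h_succ : (N + (n + 1)).toNat = (N + n).toNat + 1 := by
      simp only [Set.mem_Ici] at hn
      omega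
    simp only [h_succ, Function.iterate_succ_apply']
  exact hN h_segment

theorem exists_isOpen_forall_inv_mul_iterate_mem (hα : Continuous α)
    (hUo : IsOpen (U : Set G)) (hUc : IsCompact (U : Set G)) :
    ∃ V : Subgroup G, IsOpen (V : Set G) ∧ ∀ x ∈ V, ∃ a ∈ biinfiniteOrbits α,
      (∀ n ≤ 0, a n ∈ U) ∧ ∀ n : ℕ, (a n)⁻¹ * α^[n] x ∈ U := by
  obtain ⟨N, hN⟩ := exists_forall_iterate_mem_past hα hUo hUc
  refine ⟨iteratesMemSubgroup α U N, isOpen_iteratesMemSubgroup hα hUo N, fun x hx => ?_⟩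
  let F : ℕ → Set (ℤ → G) := fun M =>
    orbitsWithPastIn α Set.univ U ∩ {f | ∀ i ≤ N + M, (f i)⁻¹ * α^[i] x ∈ U}
  have hF_closed : ∀ M, IsClosed {f : ℤ → G | ∀ i ≤ N + M, (f i)⁻¹ * α^[i] x ∈ U} := fun M => by
    simp only [Set.ofPred_forall]
    exact isClosed_biInter fun i _ => (U.isClosed_of_isOpen hUo).preimage
      ((continuous_apply (i : ℤ)).inv.mul continuous_const)
  have h_compact : IsCompact (orbitsWithPastIn α Set.univ (U : Set G)) :=
    isCompact_orbitsWithPastIn hα (Set.subset_univ _) hUc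
  obtain ⟨a, ha⟩ := IsCompact.nonempty_iInter_of_sequence_nonempty_isCompact_isClosed F
    (fun M f hf => ⟨hf.1, fun i hi => hf.2 i (by omega)⟩)
    (exists_past_forall_le_inv_mul_iterate_mem hN hx)
    (h_compact.inter_right (hF_closed 0)) fun M => h_compact.isClosed.inter (hF_closed M)
  rw [Set.mem_iInter] at ha
  obtain ⟨ha_orbit, ha_past⟩ := mem_orbitsWithPastIn_univ.1 (ha 0).1
  exact ⟨a, ha_orbit, ha_past, fun n => (ha n).2 n (Nat.le_add_left n N)⟩

theorem exists_localProductStructure (hα : Continuous α)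
    (hUo : IsOpen (U : Set G)) (hUc : IsCompact (U : Set G)) :
    ∃ (V : Subgroup G) (L : Set G), IsOpen (V : Set G) ∧ IsCompact L ∧
      LocalProductStructure (biinfiniteOrbits α) U V L ∧
      ∀ x ∈ V, ∃ a ∈ biinfiniteOrbits α,
        (∀ n ≤ 0, a n ∈ U) ∧ ∀ n : ℕ, (a n)⁻¹ * α^[n] x ∈ U := by
  obtain ⟨V, hV, h_factor⟩ := exists_isOpen_forall_inv_mul_iterate_mem hα hUo hUc
  obtain ⟨L, hL, h_homoclinic⟩ := exists_isCompact_of_homoclinic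
    (isShiftInvariant_biinfiniteOrbits (α := α)) hUo hUc (hUc.image hα)
    fun f hf hf_past => ⟨f (-1), hf_past (-1) (by norm_num), hf (-1)⟩
  refine ⟨V, L, hV, hL, ⟨isShiftInvariant_biinfiniteOrbits, fun f hf hf0 => ?_,
    h_homoclinic⟩, h_factor⟩
  obtain ⟨a, ha, ha_past, h_future⟩ := h_factor (f 0) hf0
  refine ⟨a, ha, a⁻¹ * f, mul_mem (inv_mem ha) hf, ha_past, fun n hn => ?_,
    mul_inv_cancel_left a f⟩
  lift n to ℕ using hn
  simpa [iterate_apply_zero fun m _ => hf m] using h_future n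

end Factorization

section Parabolic

theorem hasCompactClosure_range_iff {ι X : Type*} [TopologicalSpace X] [R1Space X] {u : ι → X} :
    HasCompactClosure (Set.range u) ↔ ∃ K, IsCompact K ∧ ∀ i, u i ∈ K :=
  ⟨fun h => ⟨_, h, fun i => subset_closure ⟨i, rfl⟩⟩, fun ⟨_, hK, hu⟩ =>
    hK.closure_of_subset (Set.range_subset_iff.2 hu)⟩

variable {G : Type*} [Group G] [TopologicalSpace G] [IsTopologicalGroup G]
  {α : G →* G} {x : G}

theorem mem_parabolic_iff :
    x ∈ parabolic α ↔ ∃ K, IsCompact K ∧ ∀ n : ℕ, α^[n] x ∈ K :=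
  hasCompactClosure_range_iff

theorem mem_antiParabolic_iff :
    x ∈ antiParabolic α ↔ ∃ f ∈ biinfiniteOrbits α, f 0 = x ∧
      ∃ K, IsCompact K ∧ ∀ n ≤ 0, f n ∈ K := by
  constructor
  · rintro ⟨u, hu, hu_bdd⟩
    obtain ⟨K, hK, huK⟩ := hasCompactClosure_range_iff.1 hu_bdd
    obtain ⟨f, hf, hfu⟩ := hu.exists_biinfiniteOrbits
    refine ⟨f, hf, by simpa [hu.1] using hfu 0, K, hK, fun n hn => ?_⟩
    obtain ⟨k, rfl⟩ := Int.exists_eq_neg_ofNat hn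
    exact hfu k ▸ huK k
  · rintro ⟨f, hf, rfl, K, hK, hfK⟩
    refine ⟨fun n => f (-n), ⟨by simp, fun n => ?_⟩,
      hasCompactClosure_range_iff.2 ⟨K, hK, fun n => hfK _ (by omega)⟩⟩
    rw [hf]
    congr 1
    omega

/-- The parabolic subgroup of an endomorphism, as a bundled subgroup with carrier `parabolic α`. -/
def parabolicSubgroup (α : G →* G) : Subgroup G where
  carrier := parabolic α
  mul_mem' {x y} hx hy := by
    obtain ⟨K, hK, hxK⟩ := mem_parabolic_iff.1 hx
    obtain ⟨L, hL, hyL⟩ := mem_parabolic_iff.1 hy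
    exact mem_parabolic_iff.2 ⟨K * L, hK.mul hL, fun n => by
      rw [iterate_map_mul]; exact Set.mul_mem_mul (hxK n) (hyL n)⟩
  one_mem' := mem_parabolic_iff.2 ⟨{1}, isCompact_singleton, iterate_map_one α⟩
  inv_mem' {x} hx := by
    obtain ⟨K, hK, hxK⟩ := mem_parabolic_iff.1 hx
    exact mem_parabolic_iff.2 ⟨K⁻¹, hK.inv, fun n => by
      rw [iterate_map_inv]; exact Set.inv_mem_inv.2 (hxK n)⟩

/-- The anti-parabolic subgroup of an endomorphism, as a bundled subgroup with carrier
`antiParabolic α`. -/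
def antiParabolicSubgroup (α : G →* G) : Subgroup G where
  carrier := antiParabolic α
  mul_mem' {x y} hx hy := by
    obtain ⟨f, hf, rfl, K, hK, hfK⟩ := mem_antiParabolic_iff.1 hx
    obtain ⟨g, hg, rfl, L, hL, hgL⟩ := mem_antiParabolic_iff.1 hy
    exact mem_antiParabolic_iff.2 ⟨f * g, mul_mem hf hg, rfl, K * L, hK.mul hL,
      fun n hn => Set.mul_mem_mul (hfK n hn) (hgL n hn)⟩
  one_mem' := mem_antiParabolic_iff.2
    ⟨1, one_mem _, rfl, {1}, isCompact_singleton, fun _ _ => rfl⟩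
  inv_mem' {x} hx := by
    obtain ⟨f, hf, rfl, K, hK, hfK⟩ := mem_antiParabolic_iff.1 hx
    exact mem_antiParabolic_iff.2 ⟨f⁻¹, inv_mem hf, rfl, K⁻¹, hK.inv,
      fun n hn => Set.inv_mem_inv.2 (hfK n hn)⟩

theorem map_mem_parabolicSubgroup (hx : x ∈ parabolicSubgroup α) :
    α x ∈ parabolicSubgroup α := by
  obtain ⟨K, hK, hxK⟩ := mem_parabolic_iff.1 hx
  exact mem_parabolic_iff.2 ⟨K, hK, fun n => hxK (n + 1)⟩

theorem map_mem_antiParabolicSubgroup (hx : x ∈ antiParabolicSubgroup α) :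
    α x ∈ antiParabolicSubgroup α := by
  obtain ⟨f, hf, rfl, K, hK, hfK⟩ := mem_antiParabolic_iff.1 hx
  refine mem_antiParabolic_iff.2 ⟨fun n => f (n + 1), isShiftInvariant_biinfiniteOrbits f hf 1,
    (hf 0).symm, insert (f 1) K, hK.insert _, fun n hn => ?_⟩
  rcases hn.eq_or_lt with rfl | hn
  · exact Set.mem_insert _ _
  · exact Set.mem_insert_of_mem _ (hfK _ hn)

variable [T2Space G] {U : Subgroup G}

theorem isClosed_parabolicSubgroup (hα : Continuous α) (hUo : IsOpen (U : Set G))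
    (hUc : IsCompact (U : Set G)) : IsClosed (parabolicSubgroup α : Set G) := by
  obtain ⟨V, L, hV, hL, h_product, h_factor⟩ := exists_localProductStructure hα hUo hUc
  have hC : IsCompact ((U : Set G) * L * (U : Set G)) := (hUc.mul hL).mul hUc
  have h_bound : ∀ x ∈ V, x ∈ parabolic α → ∀ n : ℕ, α^[n] x ∈ (U : Set G) * L * (U : Set G) := by
    intro x hxV hx n
    obtain ⟨K, hK, hxK⟩ := mem_parabolic_iff.1 hx
    obtain ⟨a, ha, ha_past, h_future⟩ := h_factor x hxV
    have ha_bdd : ∀ n ≥ 0, a n ∈ K * (U : Set G) := fun n hn => by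
      lift n to ℕ using hn
      exact ⟨_, hxK n, _, U.inv_mem (h_future n), by simp⟩
    have ha_mem := h_product.mem_mul_of_past_mem hV (hK.mul hUc) ha ha_past ha_bdd
    exact ⟨a n, ha_mem n n.cast_nonneg, _, h_future n, mul_inv_cancel_left _ _⟩
  refine isClosed_subgroup_of_isClosed_inter hV V.one_mem ?_
  have h_eq : (parabolicSubgroup α : Set G) ∩ V =
      (⋂ n : ℕ, α^[n] ⁻¹' ((U : Set G) * L * (U : Set G))) ∩ V := by
    refine Set.ext fun x => and_congr_left fun hxV => ?_
    rw [Set.mem_iInter]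
    exact ⟨h_bound x hxV, fun h => mem_parabolic_iff.2 ⟨_, hC, h⟩⟩
  rw [h_eq]
  exact (isClosed_iInter fun n => hC.isClosed.preimage (hα.iterate n)).inter
    (V.isClosed_of_isOpen hV)

theorem isClosed_antiParabolicSubgroup (hα : Continuous α) (hUo : IsOpen (U : Set G))
    (hUc : IsCompact (U : Set G)) : IsClosed (antiParabolicSubgroup α : Set G) := by
  obtain ⟨V, L, hV, hL, h_product, -⟩ := exists_localProductStructure hα hUo hUc
  have hC : IsCompact ((U : Set G) * L * (U : Set G)) := (hUc.mul hL).mul hUc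
  have h_bound : ∀ f ∈ biinfiniteOrbits α, f 0 ∈ V → ∀ K, IsCompact K → (∀ n ≤ 0, f n ∈ K) →
      ∀ n ≤ 0, f n ∈ (U : Set G) * L * (U : Set G) := by
    intro f hf hf0 K hK hfK n hn
    simpa using h_product.timeReversal.mem_mul_mul_of_bounded hV hUc hK
      (f := fun n => f (-n)) (by simpa [mem_timeReversal] using hf) hf0
      (fun n hn => hfK _ (by omega)) (-n) (by omega)
  refine isClosed_subgroup_of_isClosed_inter hV V.one_mem ?_
  have h_eq : (antiParabolicSubgroup α : Set G) ∩ V =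
      (fun f => f 0) '' orbitsWithPastIn α Set.univ ((U : Set G) * L * (U : Set G)) ∩ V := by
    refine Set.ext fun x => and_congr_left fun hxV => ⟨fun hx => ?_, ?_⟩
    · obtain ⟨f, hf, rfl, K, hK, hfK⟩ := mem_antiParabolic_iff.1 hx
      exact ⟨f, mem_orbitsWithPastIn_univ.2 ⟨hf, h_bound f hf hxV K hK hfK⟩, rfl⟩
    · rintro ⟨f, hf, rfl⟩
      obtain ⟨hf_orbit, hf_past⟩ := mem_orbitsWithPastIn_univ.1 hf
      exact mem_antiParabolic_iff.2 ⟨f, hf_orbit, rfl, _, hC, hf_past⟩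
  rw [h_eq]
  exact ((isCompact_orbitsWithPastIn hα (Set.subset_univ _) hC).image
    (continuous_apply 0)).isClosed.inter (V.isClosed_of_isOpen hV)

end Parabolic

theorem mainTheorem8_general {G : Type*} [Group G] [TopologicalSpace G] [IsTopologicalGroup G]
    [T2Space G] {U : Subgroup G} (hUo : IsOpen (U : Set G)) (hUc : IsCompact (U : Set G))
    (α : G →ₜ* G) :
    IsClosedInvariantSubgroup α (parabolic α) ∧
      IsClosedInvariantSubgroup α (antiParabolic α) ∧
      IsClosedInvariantSubgroup α (levi α) := by
  have hα : Continuous (α : G →* G) := α.continuous_toFun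
  have hP := isClosed_parabolicSubgroup hα hUo hUc
  have hA := isClosed_antiParabolicSubgroup hα hUo hUc
  exact ⟨⟨parabolicSubgroup α, rfl, hP, fun _ => map_mem_parabolicSubgroup⟩,
    ⟨antiParabolicSubgroup α, rfl, hA, fun _ => map_mem_antiParabolicSubgroup⟩,
    ⟨parabolicSubgroup α ⊓ antiParabolicSubgroup α, rfl, hP.inter hA, fun _ hx =>
      ⟨map_mem_parabolicSubgroup hx.1, map_mem_antiParabolicSubgroup hx.2⟩⟩⟩

theorem mainTheorem8 {G : Type*} [Group G] [TopologicalSpace G] [IsTopologicalGroup G]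
    [LocallyCompactSpace G] [TotallyDisconnectedSpace G] (α : G →ₜ* G) :
    IsClosedInvariantSubgroup α (parabolic α) ∧
      IsClosedInvariantSubgroup α (antiParabolic α) ∧
      IsClosedInvariantSubgroup α (levi α) := by
  obtain ⟨U, hUo, hUc⟩ := exists_subgroup_isOpen_isCompact (G := G)
  exact mainTheorem8_general hUo hUc α
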